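/- Let $\mathbf Q_n=(f_n,h_n)$, $n\ge 1$, be i.i.d. random pairs of probability measures on $\mathbb N=\{0,1,2,\dots\}$ (for fixed $n$ the components $f_n$ and $h_n$ may be dependent), and let $\xi=(\mathbf Q_1,\mathbf Q_2,\dots)$. For an integer $k\ge 1$ let $(Z_n)_{n\ge 0}$ be a branching process with immigration in the random environment $\xi$ that starts from $k$ individuals: $Z_0=k$ and, given $\xi$, $(Z_n)$ is a Markov chain such that, given $\xi$ and $Z_{n-1}=z$, $Z_n$ has the law of $N_{n,1}+\dots+N_{n,z}+Y_n$, where $N_{n,1},N_{n,2},\dots$ are i.i.d. with distribution $f_n$ and independent of $Y_n$, which has distribution $h_n$. Write $\mathbb P_k$ for the (annealed) probability when $Z_0=k$, and put $m_1=\sum_{j\ge 0} j f_1(\{j\})$. Assume $0<m_1<\infty$ a.s., $\mathbb E\log m_1\in(0,\infty)$ and $\mathbb P(h_1(\{0\})<1)>0$, and moreover: (A) $\mathbb P\big(h_1(\{0\})>0,\ f_1(\{0\})>0,\ f_1(\{1\})>0\big)>0$; (B) there is $\delta\in(0,1)$ with $f_1(\{0\})<\delta$ a.s.; (C) there are $q>1$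 and $p\in(1,2]$ such that $$\mathbb E\Big[(1+|\log m_1|^q)\Big(\Big(\frac{N_{1,1}}{m_1}\Big)^p+1\Big)\Big]<\infty\quad\text{and}\quad \mathbb E[Y_1^p]<\infty .$$ Let $\mu=\mathbb E\log m_1$ and $\sigma=\sqrt{\operatorname{Var}(\log m_1)}$. If $\mathbb E(\log m_1)^2<\infty$ and $\sigma>0$, then for every $k\ge 1$ and every $x\in\mathbb R$, $$\lim_{n\to\infty}\mathbb P_k\Big(\frac{\log Z_n-n\mu}{\sqrt n\,\sigma}\le x\ \Big|\ Z_n>0\Big)=\frac1{\sqrt{2\pi}}\int_{-\infty}^x e^{-y^2/2}\,dy .$$ -/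

import Mathlib

open MeasureTheory ProbabilityTheory Filter Topology
open scoped ENNReal

namespace BPIRE

/-- The state space of the environment at one time: pairs `(f, h)` of probability measures on `ℕ`,
`f` being the offspring distribution and `h` the immigration distribution. The `σ`-algebra is
generated by the evaluations, that is, it is the Borel `σ`-algebra of total variation. -/
abbrev Env : Type := ProbabilityMeasure ℕ × ProbabilityMeasure ℕ

/-- The law of `N₁ + ⋯ + N_z + Y`, where `N₁, …, N_z` are i.i.d. with distribution `q.1` and
independent of `Y`, which has distribution `q.2`. -/
noncomputable def stepLaw (q : Env) (z : ℕ) : Measure ℕ :=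
  ((Measure.pi fun _ : Fin z => (q.1 : Measure ℕ)).prod (q.2 : Measure ℕ)).map
    fun x => (∑ i, x.1 i) + x.2

/-- The mean `∑ j, j * f {j}` of the offspring distribution, possibly infinite. -/
noncomputable def mean (q : Env) : ℝ≥0∞ := ∑' j : ℕ, (j : ℝ≥0∞) * (q.1 : Measure ℕ) {j}

/-- The logarithm of the mean of the offspring distribution
(meaningful if the mean is positive and finite). -/
noncomputable def logMean (q : Env) : ℝ := Real.log (mean q).toReal

variable {Ω : Type*} [MeasurableSpace Ω]

/-- `Q 0, Q 1, …` are i.i.d. random pairs of distributions; `Q n` is the environment that governs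
the step from time `n` to time `n + 1`. The two components of `Q n` may depend on each other. -/
structure IsEnvironment (P : Measure Ω) (Q : ℕ → Ω → Env) : Prop where
  measurable : ∀ n, Measurable (Q n)
  indep : iIndepFun Q P
  identDistrib : ∀ n, IdentDistrib (Q n) (Q 0) P P

/-- The information given by the whole environment and by `Z 0, …, Z n`. -/
@[reducible] def history (Q : ℕ → Ω → Env) (Z : ℕ → Ω → ℕ) (n : ℕ) : MeasurableSpace Ω :=
  MeasurableSpace.comap
    (fun ω => ((fun i : ℕ => Q i ω), (fun i : Fin (n + 1) => Z i ω))) inferInstance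

/-- `Z` is a branching process with immigration in the random environment `Q` that starts from `k`
individuals: given the environment, `Z` is a Markov chain, and given also `Z n = z` the size
`Z (n + 1)` is distributed as the sum of `z` i.i.d. variables with the offspring distribution of
`Q n` and of an independent variable with the immigration distribution of `Q n`. -/
structure IsProcess (P : Measure Ω) (Q : ℕ → Ω → Env) (k : ℕ) (Z : ℕ → Ω → ℕ) : Prop where
  measurable : ∀ n, Measurable (Z n)
  initial : ∀ᵐ ω ∂P, Z 0 ω = k
  transition : ∀ n j : ℕ,
    P[Set.indicator {ω | Z (n + 1) ω = j} (fun _ => (1 : ℝ)) | history Q Z n]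
      =ᵐ[P] fun ω => (stepLaw (Q n ω) (Z n ω)).real {j}

/-- Standing assumptions on the law of `Q₁ = (f, h)`: the offspring mean is a.s. positive and
finite, the expectation of its logarithm is positive and finite, and immigration is possible. -/
structure IsSupercritical (P : Measure Ω) (Q₁ : Ω → Env) : Prop where
  mean_pos : ∀ᵐ ω ∂P, 0 < mean (Q₁ ω)
  mean_lt_top : ∀ᵐ ω ∂P, mean (Q₁ ω) < ∞
  integrable : Integrable (fun ω => logMean (Q₁ ω)) P
  drift_pos : 0 < ∫ ω, logMean (Q₁ ω) ∂P
  immigration : 0 < P {ω | ((Q₁ ω).2 : Measure ℕ) {0} < 1}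

/-- With positive probability, `h {0}`, `f {0}` and `f {1}` are all positive. -/
def AssumptionA (P : Measure Ω) (Q₁ : Ω → Env) : Prop :=
  0 < P {ω | 0 < ((Q₁ ω).2 : Measure ℕ) {0} ∧ 0 < ((Q₁ ω).1 : Measure ℕ) {0} ∧
    0 < ((Q₁ ω).1 : Measure ℕ) {1}}

/-- There is a constant `δ ∈ (0, 1)` with `f {0} < δ` almost surely. -/
def AssumptionB (P : Measure Ω) (Q₁ : Ω → Env) : Prop :=
  ∃ δ : ℝ, 0 < δ ∧ δ < 1 ∧ ∀ᵐ ω ∂P, ((Q₁ ω).1 : Measure ℕ).real {0} < δ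

/-- There are `q > 1` and `p ∈ (1, 2]` with `E[(1 + |log m|^q) ((N / m)^p + 1)] < ∞` and
`E[Y^p] < ∞`. Here, given the environment `(f, h)`, `m` is the mean of `f`, and `N` and `Y` have
the distributions `f` and `h`, so that the inner integrals are the conditional expectations. -/
def AssumptionC (P : Measure Ω) (Q₁ : Ω → Env) : Prop :=
  ∃ q p : ℝ, 1 < q ∧ 1 < p ∧ p ≤ 2 ∧
    (∫⁻ ω, ∫⁻ N : ℕ, ENNReal.ofReal
        ((1 + |logMean (Q₁ ω)| ^ q) * (((N : ℝ) / (mean (Q₁ ω)).toReal) ^ p + 1))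
        ∂((Q₁ ω).1 : Measure ℕ) ∂P) < ∞ ∧
    (∫⁻ ω, ∫⁻ Y : ℕ, ENNReal.ofReal ((Y : ℝ) ^ p) ∂((Q₁ ω).2 : Measure ℕ) ∂P) < ∞

end BPIRE

/-!
Let `S_n` be the random walk with increments `log m_i`. The theorem follows from the central limit
theorem for `S_n` once `(log Z_n - S_n) / √n` tends to `0` in probability and `P (Z_n = 0)` tends to
`0`. For both it is enough that, for every deterministic sequence `b_n → ∞`, with probability
tending to one `1 / b_n < Z_n * exp (-S_n) < b_n`; take `b_n = exp (ε * √n)`.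

*Upper bound* (`tendsto_measure_population_large`). Given the environment, the mean of
`Z_n * exp (-S_n)` is `k + ∑_{i < n} E[Y_i] * exp (-S_{i+1})`. By the strong law of large numbers
`S_n` grows linearly, so this stays bounded in `n` almost surely, and Markov's inequality applies.

*Lower bound* (`tendsto_measure_population_small`). The probability in question is at most `exp 1`
times the expectation of the generating function of `Z_n` at `exp (-b_n * exp (-S_n))`, given the
environment. That generating function is a product over the times of arrival of the immigrants,
whose factors are the immigration generating functions evaluated at compositions of offspring
generating functions (`quenchedGen_le_prod`). The inequality `exp (-u) ≤ 1 - u + u ^ p` shows that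
these compositions are linear up to a relative error which is controlled by the almost surely finite
series `deviation` (`comp_exp_neg_le`). Hence every time at which immigration is likely and the
deviation of the environment from then on is small contributes a factor bounded away from `1`.
By stationarity and Kolmogorov's 0-1 law there are infinitely many such times
(`IsEnvironment.ae_frequently_shift_mem`), so the generating function tends to `0` almost surely
(`tendsto_quenchedGen_zero`), and so does its expectation by dominated convergence. In particular
no survival estimate for the descendants of a single individual is required.
-/

namespace BPIRE

/-! ### Generating functions of one step -/

/-- The probability generating function `∑ j, s ^ j * ν {j}` of a distribution on `ℕ`. -/
noncomputable def gen (ν : ProbabilityMeasure ℕ) (s : ℝ≥0∞) : ℝ≥0∞ :=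
  ∑' j : ℕ, s ^ j * (ν : Measure ℕ) {j}

/-- The mean `∑ j, j * h {j}` of the immigration distribution, possibly infinite. -/
noncomputable def immMean (q : Env) : ℝ≥0∞ := ∑' j : ℕ, (j : ℝ≥0∞) * (q.2 : Measure ℕ) {j}

lemma gen_eq_lintegral (ν : ProbabilityMeasure ℕ) (s : ℝ≥0∞) :
    gen ν s = ∫⁻ j, s ^ j ∂(ν : Measure ℕ) := (lintegral_countable' _).symm

lemma mean_eq_lintegral (q : Env) : mean q = ∫⁻ j, (j : ℝ≥0∞) ∂(q.1 : Measure ℕ) :=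
  (lintegral_countable' _).symm

lemma immMean_eq_lintegral (q : Env) : immMean q = ∫⁻ j, (j : ℝ≥0∞) ∂(q.2 : Measure ℕ) :=
  (lintegral_countable' _).symm

lemma measurable_apply_singleton (j : ℕ) :
    Measurable fun ν : ProbabilityMeasure ℕ => (ν : Measure ℕ) {j} :=
  (Measure.measurable_coe (measurableSet_singleton j)).comp measurable_subtype_coe

lemma measurable_gen : Measurable fun x : ProbabilityMeasure ℕ × ℝ≥0∞ => gen x.1 x.2 := by
  refine Measurable.tsum fun j => ?_
  exact (measurable_snd.pow_const j).mul ((measurable_apply_singleton j).comp measurable_fst)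

lemma measurable_mean : Measurable mean :=
  Measurable.tsum fun j =>
    ((measurable_apply_singleton j).comp measurable_fst).const_mul _

lemma measurable_immMean : Measurable immMean :=
  Measurable.tsum fun j =>
    ((measurable_apply_singleton j).comp measurable_snd).const_mul _

lemma measurable_logMean : Measurable logMean :=
  Real.measurable_log.comp measurable_mean.ennreal_toReal

lemma gen_mono (ν : ProbabilityMeasure ℕ) : Monotone (gen ν) := fun _ _ h =>
  ENNReal.tsum_le_tsum fun _ => mul_le_mul_left (pow_le_pow_left' h _) _

lemma gen_le_one (ν : ProbabilityMeasure ℕ) {s : ℝ≥0∞} (hs : s ≤ 1) : gen ν s ≤ 1 := by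
  rw [gen_eq_lintegral]
  calc ∫⁻ j, s ^ j ∂(ν : Measure ℕ) ≤ ∫⁻ _, 1 ∂(ν : Measure ℕ) :=
        lintegral_mono fun j => pow_le_one' hs j
    _ = 1 := by simp

lemma lintegral_stepLaw (q : Env) (z : ℕ) (g : ℕ → ℝ≥0∞) :
    ∑' j, g j * stepLaw q z {j} =
      ∫⁻ x : Fin z → ℕ, ∫⁻ y, g ((∑ i, x i) + y) ∂(q.2 : Measure ℕ)
        ∂(Measure.pi fun _ : Fin z => (q.1 : Measure ℕ)) := by
  rw [← lintegral_countable', stepLaw, lintegral_map (measurable_of_countable _) (by fun_prop),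
    lintegral_prod _ (measurable_of_countable _).aemeasurable]

lemma isProbabilityMeasure_stepLaw (q : Env) (z : ℕ) : IsProbabilityMeasure (stepLaw q z) :=
  Measure.isProbabilityMeasure_map (by fun_prop)

lemma gen_stepLaw (q : Env) (z : ℕ) (s : ℝ≥0∞) :
    ∑' j, s ^ j * stepLaw q z {j} = gen q.1 s ^ z * gen q.2 s := by
  rw [lintegral_stepLaw]
  have h (x : Fin z → ℕ) : ∫⁻ y, s ^ ((∑ i, x i) + y) ∂(q.2 : Measure ℕ) =
      (∏ i, s ^ x i) * gen q.2 s := by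
    simp_rw [pow_add]
    rw [lintegral_const_mul _ (measurable_of_countable _), gen_eq_lintegral,
      Finset.prod_pow_eq_pow_sum]
  simp_rw [h]
  rw [lintegral_mul_const _ (measurable_of_countable _),
    lintegral_prod_eq_prod_lintegral_of_indepFun (Finset.univ) (fun i (x : Fin z → ℕ) => s ^ x i)
      ?_ (fun i => measurable_of_countable _)]
  · congr 1
    rw [Finset.prod_congr rfl fun i _ => ?_, Finset.prod_const, Finset.card_univ, Fintype.card_fin]
    rw [gen_eq_lintegral]
    exact (measurePreserving_eval (fun _ : Fin z => (q.1 : Measure ℕ)) i).lintegral_comp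
      (f := fun j : ℕ => s ^ j) (measurable_of_countable _)
  · exact iIndepFun_pi (X := fun _ (j : ℕ) => s ^ j)
      fun i => (measurable_of_countable _).aemeasurable

lemma mean_stepLaw (q : Env) (z : ℕ) :
    ∑' j : ℕ, (j : ℝ≥0∞) * stepLaw q z {j} = z * mean q + immMean q := by
  rw [lintegral_stepLaw]
  have h (x : Fin z → ℕ) : ∫⁻ y, (((∑ i, x i) + y : ℕ) : ℝ≥0∞) ∂(q.2 : Measure ℕ) =
      (∑ i, (x i : ℝ≥0∞)) + immMean q := by
    simp_rw [Nat.cast_add]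
    rw [lintegral_add_left (measurable_of_countable _), immMean_eq_lintegral]
    simp
  simp_rw [h]
  rw [lintegral_add_left (measurable_of_countable _),
    lintegral_finsetSum _ fun i _ => measurable_of_countable _]
  congr 1
  · rw [Finset.sum_congr rfl fun i _ => ?_, Finset.sum_const, Finset.card_univ, Fintype.card_fin,
      nsmul_eq_mul]
    rw [mean_eq_lintegral]
    exact (measurePreserving_eval (fun _ : Fin z => (q.1 : Measure ℕ)) i).lintegral_comp
      (f := fun j : ℕ => (j : ℝ≥0∞)) (measurable_of_countable _)
  · simp

/-! ### Averaging over one step -/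

variable {Ω : Type*} [MeasurableSpace Ω] {P : Measure Ω} {Q : ℕ → Ω → Env} {k : ℕ}
  {Z : ℕ → Ω → ℕ}

lemma history_le (hQ : ∀ n, Measurable (Q n)) (hZ : ∀ n, Measurable (Z n)) (n : ℕ) :
    history Q Z n ≤ ‹MeasurableSpace Ω› :=
  Measurable.comap_le ((measurable_pi_lambda _ hQ).prodMk (measurable_pi_lambda _ fun i => hZ i))

lemma IsProcess.aemeasurable_stepLaw (hZ : IsProcess P Q k Z) (n j : ℕ) :
    AEMeasurable (fun ω => stepLaw (Q n ω) (Z n ω) {j}) P := by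
  have h1 : AEMeasurable (fun ω => (stepLaw (Q n ω) (Z n ω)).real {j}) P :=
    (integrable_condExp.aestronglyMeasurable.congr (hZ.transition n j)).aemeasurable
  refine h1.ennreal_ofReal.congr (ae_of_all _ fun ω => ?_)
  have := isProbabilityMeasure_stepLaw (Q n ω) (Z n ω)
  simp

/-- The transition rule for a single target state, tested against a weight depending on the
environment. -/
lemma lintegral_mul_indicator_succ [IsProbabilityMeasure P] (hQ : ∀ n, Measurable (Q n))
    (hZ : IsProcess P Q k Z) (n j : ℕ) {G : (ℕ → Env) → ℝ≥0∞} (hG : Measurable G) :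
    ∫⁻ ω, G (fun i => Q i ω) * Set.indicator {ω | Z (n + 1) ω = j} 1 ω ∂P =
      ∫⁻ ω, G (fun i => Q i ω) * stepLaw (Q n ω) (Z n ω) {j} ∂P := by
  have hm := history_le hQ hZ.measurable n
  have hset : MeasurableSet {ω | Z (n + 1) ω = j} :=
    hZ.measurable (n + 1) (measurableSet_singleton j)
  have htr := hZ.transition n j
  have hp := hZ.aemeasurable_stepLaw n j
  have hG' : Measurable[history Q Z n] fun ω => G (fun i => Q i ω) :=
    (hG.comp measurable_fst).comp (comap_measurable _)
  -- the measures with the two densities agree on the events of the history up to time `n`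
  have key : (P.withDensity (Set.indicator {ω | Z (n + 1) ω = j} 1)).trim hm =
      (P.withDensity fun ω => stepLaw (Q n ω) (Z n ω) {j}).trim hm := by
    refine @Measure.ext _ (history Q Z n) _ _ fun A hA => ?_
    rw [trim_measurableSet_eq hm hA, trim_measurableSet_eq hm hA,
      withDensity_apply _ (hm _ hA), withDensity_apply _ (hm _ hA)]
    have h1 := setIntegral_condExp hm
      (f := Set.indicator {ω | Z (n + 1) ω = j} (fun _ => (1 : ℝ))) (μ := P)
      ((integrable_const 1).indicator hset) hA
    rw [setIntegral_congr_ae (hm _ hA) (htr.mono fun ω h _ => h),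
      integral_indicator hset, integral_eq_lintegral_of_nonneg_ae] at h1
    rotate_left
    · exact ae_of_all _ fun ω => measureReal_nonneg
    · exact ((integrable_condExp.aestronglyMeasurable.congr htr)).restrict
    rw [lintegral_indicator_one hset]
    simp only [integral_const, smul_eq_mul, mul_one, measureReal_def,
      Measure.restrict_apply_univ] at h1
    rw [ENNReal.toReal_eq_toReal_iff' ?_ (by finiteness)] at h1
    · rw [← h1]
      refine lintegral_congr fun ω => ?_
      have := isProbabilityMeasure_stepLaw (Q n ω) (Z n ω)
      simp
    · refine ne_top_of_le_ne_top (b := ∫⁻ _ in A, 1 ∂P) (by simp) (lintegral_mono fun ω => ?_)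
      have := isProbabilityMeasure_stepLaw (Q n ω) (Z n ω)
      simpa using prob_le_one
  have h2 := congrArg (fun ν => ∫⁻ ω, G (fun i => Q i ω) ∂ν) key
  simp only [lintegral_trim hm hG'] at h2
  rw [lintegral_withDensity_eq_lintegral_mul₀ (measurable_one.indicator hset).aemeasurable
    (hG'.mono hm le_rfl).aemeasurable, lintegral_withDensity_eq_lintegral_mul₀ hp
    (hG'.mono hm le_rfl).aemeasurable] at h2
  simpa [mul_comm] using h2

/-- The annealed form of the transition rule: given the environment, the expectation of a function
of the next generation is obtained by averaging over `stepLaw`. -/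
lemma lintegral_step [IsProbabilityMeasure P] (hQ : ∀ n, Measurable (Q n))
    (hZ : IsProcess P Q k Z) (n : ℕ) {g : (ℕ → Env) → ℕ → ℝ≥0∞}
    (hg : ∀ j, Measurable fun e => g e j) :
    ∫⁻ ω, g (fun i => Q i ω) (Z (n + 1) ω) ∂P =
      ∫⁻ ω, ∑' j, g (fun i => Q i ω) j * stepLaw (Q n ω) (Z n ω) {j} ∂P := by
  have hξ : Measurable fun ω => (fun i => Q i ω) := measurable_pi_lambda _ hQ
  have h1 (ω : Ω) : g (fun i => Q i ω) (Z (n + 1) ω) =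
      ∑' j, g (fun i => Q i ω) j * Set.indicator {ω | Z (n + 1) ω = j} 1 ω := by
    rw [tsum_eq_single (Z (n + 1) ω)]
    · simp
    · intro j hj
      simp [Set.indicator, hj.symm]
  simp_rw [h1]
  rw [lintegral_tsum, lintegral_tsum]
  · exact tsum_congr fun j => lintegral_mul_indicator_succ hQ hZ n j (hg j)
  · exact fun j => ((hg j).comp hξ).aemeasurable.mul (hZ.aemeasurable_stepLaw n j)
  · exact fun j => (((hg j).comp hξ).mul (measurable_one.indicator
      (hZ.measurable (n + 1) (measurableSet_singleton j)))).aemeasurable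

/-! ### Iterated generating functions -/

/-- The moment `E[(N / m) ^ p]` of a normalized offspring number, given the environment
(meaningful if the mean `m` is positive and finite). -/
noncomputable def relMoment (p : ℝ) (q : Env) : ℝ≥0∞ :=
  ∫⁻ N : ℕ, ENNReal.ofReal (((N : ℝ) / (mean q).toReal) ^ p) ∂(q.1 : Measure ℕ)

/-- The associated random walk `logMean (e 0) + ⋯ + logMean (e (n - 1))`. -/
noncomputable def walk (e : ℕ → Env) (n : ℕ) : ℝ := ∑ i ∈ Finset.range n, logMean (e i)

/-- The composition `f₀ ∘ ⋯ ∘ f_{l-1}` of the generating functions of the offspring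
distributions. -/
noncomputable def comp (e : ℕ → Env) : ℕ → ℝ≥0∞ → ℝ≥0∞
  | 0, s => s
  | l + 1, s => comp e l (gen (e l).1 s)

/-- The generating function of the size of generation `n`, given the environment `e`, for a
population that starts from `k` individuals. -/
noncomputable def quenchedGen (k : ℕ) (e : ℕ → Env) : ℕ → ℝ≥0∞ → ℝ≥0∞
  | 0, s => s ^ k
  | n + 1, s => gen (e n).2 s * quenchedGen k e n (gen (e n).1 s)

/-- The series `∑ j, E[(N_j / m_j) ^ p] * exp (-(p - 1) * S_j)` that controls how much the iterated
generating functions deviate from their linearization. -/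
noncomputable def deviation (p : ℝ) (e : ℕ → Env) : ℝ≥0∞ :=
  ∑' j, relMoment p (e j) * ENNReal.ofReal (Real.exp (-((p - 1) * walk e j)))

lemma exp_neg_le_one_sub_add_rpow {p u : ℝ} (hp : 1 < p) (hp2 : p ≤ 2) (hu : 0 ≤ u) :
    Real.exp (-u) ≤ 1 - u + u ^ p := by
  rcases le_total u 1 with h | h
  · have h1 := (abs_le.1 (Real.abs_exp_sub_one_sub_id_le (x := -u) (by
      rwa [abs_neg, abs_of_nonneg hu]))).2
    have h2 : u ^ (2 : ℝ) ≤ u ^ p := by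
      rcases hu.eq_or_lt with rfl | h0
      · rw [Real.zero_rpow (by norm_num), Real.zero_rpow (by linarith)]
      · exact Real.rpow_le_rpow_of_exponent_ge h0 h hp2
    rw [Real.rpow_two] at h2
    nlinarith
  · have h1 : u ^ (1 : ℝ) ≤ u ^ p := Real.rpow_le_rpow_of_exponent_le h hp.le
    rw [Real.rpow_one] at h1
    have h2 : Real.exp (-u) ≤ 1 := Real.exp_le_one_iff.2 (by linarith)
    linarith

lemma exp_logMean {q : Env} (h0 : 0 < mean q) (h1 : mean q < ∞) :
    Real.exp (logMean q) = (mean q).toReal :=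
  Real.exp_log (ENNReal.toReal_pos h0.ne' h1.ne)

lemma gen_exp_neg_le {p : ℝ} (hp : 1 < p) (hp2 : p ≤ 2) {q : Env} (h0 : 0 < mean q)
    (h1 : mean q < ∞) (hK : relMoment p q < ∞) {t v : ℝ} (ht : 0 ≤ t)
    (hv : v = (mean q).toReal * t) :
    gen q.1 (ENNReal.ofReal (Real.exp (-t))) ≤
      ENNReal.ofReal (Real.exp (-(v - (relMoment p q).toReal * v ^ p))) := by
  have hm : 0 < (mean q).toReal := ENNReal.toReal_pos h0.ne' h1.ne
  have hv0 : 0 ≤ v := hv ▸ mul_nonneg hm.le ht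
  set s := ENNReal.ofReal (Real.exp (-t)) with hs
  have hs1 : s ≤ 1 := ENNReal.ofReal_le_one.2 (Real.exp_le_one_iff.2 (by linarith))
  have hgen := gen_le_one q.1 hs1
  -- the integrated form of `exp (-u) + u ≤ 1 + u ^ p` with `u = t * N = v * (N / m)`
  have key : gen q.1 s + ENNReal.ofReal v ≤
      1 + relMoment p q * ENNReal.ofReal (v ^ p) := by
    have e1 : ENNReal.ofReal v = ∫⁻ N : ℕ, ENNReal.ofReal (t * N) ∂(q.1 : Measure ℕ) := by
      simp_rw [ENNReal.ofReal_mul ht, ENNReal.ofReal_natCast]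
      rw [lintegral_const_mul _ (measurable_of_countable _), ← mean_eq_lintegral, hv,
        ENNReal.ofReal_mul hm.le, ENNReal.ofReal_toReal h1.ne, mul_comm]
    rw [gen_eq_lintegral, e1, relMoment, ← lintegral_mul_const _ (measurable_of_countable _),
      ← lintegral_add_left (measurable_of_countable _)]
    calc ∫⁻ N : ℕ, (s ^ N + ENNReal.ofReal (t * N)) ∂(q.1 : Measure ℕ)
        ≤ ∫⁻ N : ℕ, (1 + ENNReal.ofReal (((N : ℝ) / (mean q).toReal) ^ p)
            * ENNReal.ofReal (v ^ p)) ∂(q.1 : Measure ℕ) := by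
          refine lintegral_mono fun N => ?_
          have hN : (0 : ℝ) ≤ N := N.cast_nonneg
          have h2 := exp_neg_le_one_sub_add_rpow hp hp2 (mul_nonneg ht hN)
          have h3 : (t * N) ^ p = ((N : ℝ) / (mean q).toReal) ^ p * v ^ p := by
            rw [← Real.mul_rpow (by positivity) hv0, hv]
            congr 1
            field_simp
          have h4 : s ^ N = ENNReal.ofReal (Real.exp (-(t * N))) := by
            rw [hs, ← ENNReal.ofReal_pow (Real.exp_pos _).le, ← Real.exp_nat_mul]
            congr 2
            ring
          rw [h4, ← ENNReal.ofReal_mul (by positivity), ← h3, ← ENNReal.ofReal_one,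
            ← ENNReal.ofReal_add (Real.exp_pos _).le (by positivity),
            ← ENNReal.ofReal_add zero_le_one (by positivity)]
          exact ENNReal.ofReal_le_ofReal (by linarith)
      _ = _ := by
          rw [lintegral_add_left measurable_const]
          simp
  have hgt : gen q.1 s ≠ ∞ := ne_top_of_le_ne_top ENNReal.one_ne_top hgen
  have key' := ENNReal.toReal_mono (by finiteness) key
  rw [ENNReal.toReal_add hgt (by finiteness), ENNReal.toReal_add (by finiteness) (by finiteness),
    ENNReal.toReal_mul, ENNReal.toReal_ofReal hv0,
    ENNReal.toReal_ofReal (Real.rpow_nonneg hv0 p), ENNReal.toReal_one] at key'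
  rw [← ENNReal.ofReal_toReal hgt]
  refine ENNReal.ofReal_le_ofReal ?_
  have := Real.add_one_le_exp (-(v - (relMoment p q).toReal * v ^ p))
  linarith

lemma comp_mono (e : ℕ → Env) (l : ℕ) : Monotone (comp e l) := by
  induction l with
  | zero => exact monotone_id
  | succ l ih => exact ih.comp (gen_mono _)

lemma walk_succ (e : ℕ → Env) (n : ℕ) : walk e (n + 1) = walk e n + logMean (e n) :=
  Finset.sum_range_succ _ _

/-- Iterating `f (exp (-t)) ≤ exp (-(v - K * v ^ p))`, where `v = m * t`, along the environment:
the arguments `v` decay like `exp (-S_j)`, so that the relative errors add up to a partial sum of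
`deviation`. -/
lemma comp_exp_neg_le {p : ℝ} (hp : 1 < p) (hp2 : p ≤ 2) {e : ℕ → Env}
    (h0 : ∀ j, 0 < mean (e j)) (h1 : ∀ j, mean (e j) < ∞) (hK : ∀ j, relMoment p (e j) < ∞)
    (l : ℕ) {c : ℝ} (hc : 0 < c) (hsum : c ^ (p - 1) * ∑ j ∈ Finset.range l,
      (relMoment p (e j)).toReal * Real.exp (-((p - 1) * walk e j)) < 1) :
    comp e l (ENNReal.ofReal (Real.exp (-(c * Real.exp (-walk e l))))) ≤
      ENNReal.ofReal (Real.exp (-(c * (1 - c ^ (p - 1) * ∑ j ∈ Finset.range l,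
        (relMoment p (e j)).toReal * Real.exp (-((p - 1) * walk e j)))))) := by
  induction l generalizing c with
  | zero => simp [comp, walk]
  | succ l ih =>
    set A := ∑ j ∈ Finset.range l,
      (relMoment p (e j)).toReal * Real.exp (-((p - 1) * walk e j)) with hA
    set B := (relMoment p (e l)).toReal * Real.exp (-((p - 1) * walk e l)) with hB
    rw [Finset.sum_range_succ, ← hA, ← hB] at hsum ⊢
    have hA0 : 0 ≤ A := Finset.sum_nonneg fun j _ => by positivity
    have hB0 : 0 ≤ B := by positivity
    have hcp : 0 < c ^ (p - 1) := Real.rpow_pos_of_pos hc _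
    have hd0 : 0 ≤ c ^ (p - 1) * B := by positivity
    have ha0 : 0 ≤ c ^ (p - 1) * A := by positivity
    rw [mul_add] at hsum ⊢
    set δ := c ^ (p - 1) * B with hδ
    -- the innermost generating function replaces the constant `c` by `c * (1 - δ)`
    have hc' : 0 < c * (1 - δ) := mul_pos hc (by linarith)
    have hc'p : (c * (1 - δ)) ^ (p - 1) ≤ c ^ (p - 1) :=
      Real.rpow_le_rpow hc'.le (by nlinarith) (by linarith)
    have hle : (c * (1 - δ)) ^ (p - 1) * A ≤ c ^ (p - 1) * A :=
      mul_le_mul_of_nonneg_right hc'p hA0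
    have ih' := ih hc' (by linarith)
    have hv0 : 0 < c * Real.exp (-walk e l) := by positivity
    have hstep := gen_exp_neg_le hp hp2 (h0 l) (h1 l) (hK l)
      (t := c * Real.exp (-walk e (l + 1))) (v := c * Real.exp (-walk e l)) (by positivity) (by
        rw [← exp_logMean (h0 l) (h1 l), walk_succ, neg_add, Real.exp_add]
        rw [show Real.exp (logMean (e l)) * (c * (Real.exp (-walk e l) * Real.exp (-logMean (e l))))
          = c * Real.exp (-walk e l) * (Real.exp (logMean (e l)) * Real.exp (-logMean (e l))) by
            ring, ← Real.exp_add]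
        simp)
    have hpow : (c * Real.exp (-walk e l)) ^ p =
        c * Real.exp (-walk e l) * (c ^ (p - 1) * Real.exp (-((p - 1) * walk e l))) := by
      have : p = 1 + (p - 1) := by ring
      rw [this, Real.rpow_add hv0, Real.rpow_one, Real.mul_rpow hc.le (Real.exp_pos _).le,
        ← Real.exp_mul]
      ring_nf
    have heq : c * Real.exp (-walk e l) -
        (relMoment p (e l)).toReal * (c * Real.exp (-walk e l)) ^ p =
        c * (1 - δ) * Real.exp (-walk e l) := by
      rw [hpow, hδ, hB]; ring
    rw [heq] at hstep
    refine (comp_mono e l hstep).trans (ih'.trans (ENNReal.ofReal_le_ofReal ?_))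
    rw [Real.exp_le_exp, neg_le_neg_iff, mul_assoc]
    refine mul_le_mul_of_nonneg_left ?_ hc.le
    nlinarith [mul_nonneg hd0 ha0]

lemma comp_exp_neg_le_of_deviation_le {p : ℝ} (hp : 1 < p) (hp2 : p ≤ 2) {e : ℕ → Env}
    (h0 : ∀ j, 0 < mean (e j)) (h1 : ∀ j, mean (e j) < ∞) (hK : ∀ j, relMoment p (e j) < ∞)
    {r c : ℝ} (hr : 0 < r) (hdev : deviation p e ≤ ENNReal.ofReal r) (hc : 0 < c)
    (hcr : c ^ (p - 1) * r ≤ 1 / 2) (l : ℕ) :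
    comp e l (ENNReal.ofReal (Real.exp (-(c * Real.exp (-walk e l))))) ≤
      ENNReal.ofReal (Real.exp (-(c / 2))) := by
  have hA : ∑ j ∈ Finset.range l,
      (relMoment p (e j)).toReal * Real.exp (-((p - 1) * walk e j)) ≤ r := by
    have h := (ENNReal.sum_le_tsum (Finset.range l)).trans hdev
    have h2 := ENNReal.toReal_mono ENNReal.ofReal_ne_top h
    rw [ENNReal.toReal_ofReal hr.le, ENNReal.toReal_sum fun j _ =>
      ENNReal.mul_ne_top (hK j).ne ENNReal.ofReal_ne_top] at h2
    simpa [ENNReal.toReal_mul, ENNReal.toReal_ofReal (Real.exp_pos _).le] using h2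
  have hcp : 0 < c ^ (p - 1) := Real.rpow_pos_of_pos hc _
  have hle := (mul_le_mul_of_nonneg_left hA hcp.le).trans hcr
  refine (comp_exp_neg_le hp hp2 h0 h1 hK l hc (by linarith)).trans (ENNReal.ofReal_le_ofReal ?_)
  rw [Real.exp_le_exp, neg_le_neg_iff]
  nlinarith

/-- The descendants of the immigrants that arrive at different times are independent, given the
environment. Only an inequality, since the descendants of the `k` initial individuals are dropped.
-/
lemma quenchedGen_le_prod (k : ℕ) (e : ℕ → Env) (n : ℕ) {s : ℝ≥0∞} (hs : s ≤ 1) :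
    quenchedGen k e n s ≤ ∏ i ∈ Finset.range n,
      gen (e i).2 (comp (fun j => e (i + 1 + j)) (n - 1 - i) s) := by
  induction n generalizing s with
  | zero => simpa [quenchedGen] using pow_le_one' hs k
  | succ n ih =>
    rw [quenchedGen, Finset.prod_range_succ, mul_comm]
    refine mul_le_mul' ((ih (gen_le_one _ hs)).trans_eq (Finset.prod_congr rfl fun i hi => ?_))
      (by simp [comp])
    have hi' : i < n := Finset.mem_range.1 hi
    rw [show n + 1 - 1 - i = (n - 1 - i) + 1 by omega, comp,
      show i + 1 + (n - 1 - i) = n by omega]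

lemma comp_le_one (e : ℕ → Env) (l : ℕ) {s : ℝ≥0∞} (hs : s ≤ 1) : comp e l s ≤ 1 := by
  induction l generalizing s with
  | zero => exact hs
  | succ l ih => exact ih (gen_le_one _ hs)

lemma quenchedGen_le_one (k : ℕ) (e : ℕ → Env) (n : ℕ) {s : ℝ≥0∞} (hs : s ≤ 1) :
    quenchedGen k e n s ≤ 1 :=
  (quenchedGen_le_prod k e n hs).trans
    (Finset.prod_le_one' fun _ _ => gen_le_one _ (comp_le_one _ _ hs))

lemma measurable_quenchedGen (k n : ℕ) :
    Measurable fun x : (ℕ → Env) × ℝ≥0∞ => quenchedGen k x.1 n x.2 := by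
  induction n with
  | zero => exact measurable_snd.pow_const k
  | succ n ih =>
    have he : Measurable fun x : (ℕ → Env) × ℝ≥0∞ => x.1 n :=
      (measurable_pi_apply n).comp measurable_fst
    refine (measurable_gen.comp (he.snd.prodMk measurable_snd)).mul ?_
    exact ih.comp (measurable_fst.prodMk (measurable_gen.comp (he.fst.prodMk measurable_snd)))

/-- Given the environment, `Z n` has the generating function `quenchedGen k · n`; the argument `s`
and the weight `X` may depend on the environment. -/
lemma lintegral_mul_pow [IsProbabilityMeasure P] (hQ : ∀ n, Measurable (Q n))
    (hZ : IsProcess P Q k Z) (n : ℕ) {X s : (ℕ → Env) → ℝ≥0∞} (hX : Measurable X)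
    (hs : Measurable s) :
    ∫⁻ ω, X (fun i => Q i ω) * s (fun i => Q i ω) ^ Z n ω ∂P =
      ∫⁻ ω, X (fun i => Q i ω) * quenchedGen k (fun i => Q i ω) n (s fun i => Q i ω) ∂P := by
  induction n generalizing X s with
  | zero =>
    refine lintegral_congr_ae (hZ.initial.mono fun ω h => ?_)
    simp [quenchedGen, h]
  | succ n ih =>
    rw [lintegral_step (g := fun e j => X e * s e ^ j) hQ hZ n fun j => hX.mul (hs.pow_const j)]
    simp_rw [mul_assoc, ENNReal.tsum_mul_left, gen_stepLaw]
    have he : Measurable fun e : ℕ → Env => e n := measurable_pi_apply n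
    have h := ih (X := fun e => X e * gen (e n).2 (s e)) (s := fun e => gen (e n).1 (s e))
      (hX.mul (measurable_gen.comp (he.snd.prodMk hs))) (measurable_gen.comp (he.fst.prodMk hs))
    simp only [mul_assoc] at h
    simp only [quenchedGen, ← h]
    exact lintegral_congr fun ω => by ring

/-- The expected size of generation `n`, relative to the product of the offspring means, given the
environment. -/
noncomputable def normalizedMean (k : ℕ) (e : ℕ → Env) (n : ℕ) : ℝ≥0∞ :=
  k + ∑ i ∈ Finset.range n, immMean (e i) * ENNReal.ofReal (Real.exp (-walk e (i + 1)))

lemma measurable_walk (n : ℕ) : Measurable fun e : ℕ → Env => walk e n :=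
  Finset.measurable_fun_sum _ fun i _ => measurable_logMean.comp (measurable_pi_apply i)

/-- Given the environment, `Z n * exp (-S_n)` has the mean `normalizedMean k · n`; the weight `X`
may depend on the environment. -/
lemma lintegral_mul_population [IsProbabilityMeasure P] (hQ : ∀ n, Measurable (Q n))
    (hZ : IsProcess P Q k Z) (h0 : ∀ᵐ ω ∂P, ∀ n, 0 < mean (Q n ω))
    (h1 : ∀ᵐ ω ∂P, ∀ n, mean (Q n ω) < ∞) (n : ℕ) {X : (ℕ → Env) → ℝ≥0∞} (hX : Measurable X) :
    ∫⁻ ω, X (fun i => Q i ω) *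
        (ENNReal.ofReal (Real.exp (-walk (fun i => Q i ω) n)) * Z n ω) ∂P =
      ∫⁻ ω, X (fun i => Q i ω) * normalizedMean k (fun i => Q i ω) n ∂P := by
  have hw (n : ℕ) : Measurable fun e : ℕ → Env => ENNReal.ofReal (Real.exp (-walk e n)) :=
    (Real.measurable_exp.comp (measurable_walk n).neg).ennreal_ofReal
  induction n with
  | zero =>
    refine lintegral_congr_ae (hZ.initial.mono fun ω h => ?_)
    simp [normalizedMean, walk, h]
  | succ n ih =>
    rw [lintegral_step
      (g := fun e j => X e * (ENNReal.ofReal (Real.exp (-walk e (n + 1))) * j)) hQ hZ n fun j =>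
        hX.mul ((hw _).mul_const _)]
    simp_rw [mul_assoc, ENNReal.tsum_mul_left, mean_stepLaw]
    have hξ : Measurable fun ω => (fun i => Q i ω) := measurable_pi_lambda _ hQ
    simp_rw [normalizedMean, Finset.sum_range_succ, ← add_assoc, mul_add]
    have e1 : ∀ᵐ ω ∂P, ENNReal.ofReal (Real.exp (-walk (fun i => Q i ω) (n + 1))) * mean (Q n ω) =
        ENNReal.ofReal (Real.exp (-walk (fun i => Q i ω) n)) := by
      filter_upwards [h0, h1] with ω h0 h1
      rw [← ENNReal.ofReal_toReal (h1 n).ne, ← ENNReal.ofReal_mul (Real.exp_pos _).le,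
        ← exp_logMean (h0 n) (h1 n), ← Real.exp_add, walk_succ]
      congr 2
      ring
    have e2 : ∀ᵐ ω ∂P, X (fun i => Q i ω) *
          (ENNReal.ofReal (Real.exp (-walk (fun i => Q i ω) (n + 1))) *
            (Z n ω * mean (Q n ω))) =
        X (fun i => Q i ω) * (ENNReal.ofReal (Real.exp (-walk (fun i => Q i ω) n)) * Z n ω) := by
      filter_upwards [e1] with ω h
      rw [← h]
      ring
    have hW : Measurable fun ω => X (fun i => Q i ω) *
        (ENNReal.ofReal (Real.exp (-walk (fun i => Q i ω) (n + 1))) * immMean (Q n ω)) :=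
      (hX.comp hξ).mul (((hw _).comp hξ).mul (measurable_immMean.comp (hQ n)))
    rw [lintegral_add_right _ hW, lintegral_congr_ae e2, ih, ← lintegral_add_right _ hW]
    refine lintegral_congr fun ω => ?_
    simp only [normalizedMean]
    ring

/-! ### Almost sure properties of the environment -/

/-- A series whose terms are bounded in mean and carry a weight that decays exponentially with a
random rate converges almost surely. -/
lemma ae_tsum_mul_exp_neg_lt_top {a : ℕ → Ω → ℝ≥0∞} (ha : ∀ n, Measurable (a n)) {C : ℝ≥0∞}
    (hC : C < ∞) (haC : ∀ n, ∫⁻ ω, a n ω ∂P ≤ C) {T : ℕ → Ω → ℝ} {ν : ℝ} (hν : 0 < ν)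
    (hT : ∀ᵐ ω ∂P, Tendsto (fun n : ℕ => T n ω / n) atTop (𝓝 ν)) :
    ∀ᵐ ω ∂P, ∑' n, a n ω * ENNReal.ofReal (Real.exp (-T n ω)) < ∞ := by
  -- half of the asymptotic rate `ν` already makes the series of expectations converge
  set r := ENNReal.ofReal (Real.exp (-(ν / 2))) with hr
  have hr1 : r < 1 := by
    rw [hr, ENNReal.ofReal_lt_one, Real.exp_lt_one_iff]
    linarith
  have hrn (n : ℕ) : r ^ n = ENNReal.ofReal (Real.exp (-(ν / 2 * n))) := by
    rw [hr, ← ENNReal.ofReal_pow (Real.exp_pos _).le, ← Real.exp_nat_mul]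
    congr 2
    ring
  have hfin : ∀ᵐ ω ∂P, ∑' n, a n ω * r ^ n < ∞ := by
    refine ae_lt_top (Measurable.tsum fun n => (ha n).mul_const _) ?_
    rw [lintegral_tsum fun n => ((ha n).mul_const _).aemeasurable]
    refine ne_top_of_le_ne_top (b := C * (1 - r)⁻¹) ?_ ?_
    · exact ENNReal.mul_ne_top hC.ne (ENNReal.inv_ne_top.2 (tsub_pos_of_lt hr1).ne')
    · rw [← ENNReal.tsum_geometric, ← ENNReal.tsum_mul_left]
      refine ENNReal.tsum_le_tsum fun n => ?_
      rw [lintegral_mul_const _ (ha n)]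
      gcongr
      exact haC n
  filter_upwards [hfin, hT] with ω h1 h2
  have h3 : Tendsto (fun n : ℕ => Real.exp (n * (ν / 2 - T n ω / n))) atTop (𝓝 0) := by
    refine Real.tendsto_exp_atBot.comp ?_
    exact tendsto_natCast_atTop_atTop.atTop_mul_neg (C := ν / 2 - ν) (by linarith)
      (h2.const_sub _)
  obtain ⟨B, hB⟩ := h3.bddAbove_range
  -- at `n = 0` the quotient `T n / n` is a junk value: that term is split off
  have hB' (n : ℕ) (hn : n ≠ 0) :
      ENNReal.ofReal (Real.exp (-T n ω)) ≤ ENNReal.ofReal B * r ^ n := by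
    have hn' : (n : ℝ) ≠ 0 := Nat.cast_ne_zero.2 hn
    have h4 : Real.exp (n * (ν / 2 - T n ω / n)) ≤ B := hB ⟨n, rfl⟩
    rw [hrn, ← ENNReal.ofReal_mul ((Real.exp_pos _).le.trans h4)]
    refine ENNReal.ofReal_le_ofReal ?_
    calc Real.exp (-T n ω) = Real.exp (n * (ν / 2 - T n ω / n)) * Real.exp (-(ν / 2 * n)) := by
          rw [← Real.exp_add]
          congr 1
          field_simp
          ring
      _ ≤ _ := mul_le_mul_of_nonneg_right h4 (Real.exp_pos _).le
  have ha0 : a 0 ω < ∞ := by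
    have := (ENNReal.le_tsum 0).trans_lt h1
    simpa using this
  rw [tsum_eq_zero_add' ENNReal.summable]
  refine ENNReal.add_lt_top.2 ⟨ENNReal.mul_lt_top ha0 ENNReal.ofReal_lt_top, ?_⟩
  calc ∑' n, a (n + 1) ω * ENNReal.ofReal (Real.exp (-T (n + 1) ω))
      ≤ ∑' n, ENNReal.ofReal B * (a (n + 1) ω * r ^ (n + 1)) :=
        ENNReal.tsum_le_tsum fun n => by
          calc _ ≤ a (n + 1) ω * (ENNReal.ofReal B * r ^ (n + 1)) := by
                gcongr
                exact hB' _ n.succ_ne_zero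
            _ = _ := by ring
    _ = ENNReal.ofReal B * ∑' n, a (n + 1) ω * r ^ (n + 1) := ENNReal.tsum_mul_left
    _ ≤ ENNReal.ofReal B * ∑' n, a n ω * r ^ n := by
        refine mul_le_mul' le_rfl ?_
        exact ENNReal.tsum_comp_le_tsum_of_injective (add_left_injective 1)
          fun n => a n ω * r ^ n
    _ < ∞ := ENNReal.mul_lt_top ENNReal.ofReal_lt_top h1

lemma IsEnvironment.ae_tendsto_walk_div (hQ : IsEnvironment P Q)
    (hint : Integrable (fun ω => logMean (Q 0 ω)) P) :
    ∀ᵐ ω ∂P, Tendsto (fun n : ℕ => walk (fun i => Q i ω) n / n) atTop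
      (𝓝 (∫ ω, logMean (Q 0 ω) ∂P)) :=
  strong_law_ae_real (fun n ω => logMean (Q n ω)) hint
    (fun _ _ hij => (hQ.indep.comp _ fun _ => measurable_logMean).indepFun hij)
    fun n => (hQ.identDistrib n).comp measurable_logMean

lemma IsEnvironment.ae_forall (hQ : IsEnvironment P Q) {p : Env → Prop}
    (hp : MeasurableSet {q | p q}) (h : ∀ᵐ ω ∂P, p (Q 0 ω)) : ∀ᵐ ω ∂P, ∀ n, p (Q n ω) :=
  ae_all_iff.2 fun n => (hQ.identDistrib n).symm.ae_snd hp h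

lemma measurable_relMoment (p : ℝ) : Measurable (relMoment p) := by
  have : relMoment p = fun q => ∑' N : ℕ,
      ENNReal.ofReal (((N : ℝ) / (mean q).toReal) ^ p) * (q.1 : Measure ℕ) {N} :=
    funext fun q => lintegral_countable' _
  rw [this]
  refine Measurable.tsum fun N => Measurable.mul ?_ ?_
  · exact ((measurable_mean.ennreal_toReal.const_div _).pow_const p).ennreal_ofReal
  · exact (measurable_apply_singleton N).comp measurable_fst

lemma measurable_deviation (p : ℝ) : Measurable (deviation p) :=
  Measurable.tsum fun j => ((measurable_relMoment p).comp (measurable_pi_apply j)).mul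
    (Real.measurable_exp.comp ((measurable_walk j).const_mul _).neg).ennreal_ofReal

lemma lintegral_relMoment_lt_top {q p : ℝ}
    (h : ∫⁻ ω, ∫⁻ N : ℕ, ENNReal.ofReal
        ((1 + |logMean (Q 0 ω)| ^ q) * (((N : ℝ) / (mean (Q 0 ω)).toReal) ^ p + 1))
        ∂((Q 0 ω).1 : Measure ℕ) ∂P < ∞) : ∫⁻ ω, relMoment p (Q 0 ω) ∂P < ∞ := by
  refine lt_of_le_of_lt (lintegral_mono fun ω => lintegral_mono fun N =>
    ENNReal.ofReal_le_ofReal ?_) h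
  have h1 : 0 ≤ |logMean (Q 0 ω)| ^ q := Real.rpow_nonneg (abs_nonneg _) _
  have h2 : 0 ≤ ((N : ℝ) / (mean (Q 0 ω)).toReal) ^ p := by positivity
  nlinarith [mul_nonneg h1 h2]

lemma lintegral_immMean_lt_top {p : ℝ} (hp : 1 < p)
    (h : ∫⁻ ω, ∫⁻ Y : ℕ, ENNReal.ofReal ((Y : ℝ) ^ p) ∂((Q 0 ω).2 : Measure ℕ) ∂P < ∞) :
    ∫⁻ ω, immMean (Q 0 ω) ∂P < ∞ := by
  refine lt_of_le_of_lt (lintegral_mono fun ω => ?_) h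
  rw [immMean_eq_lintegral]
  refine lintegral_mono fun Y => ?_
  rw [← ENNReal.ofReal_natCast]
  refine ENNReal.ofReal_le_ofReal ?_
  rcases Y.eq_zero_or_pos with rfl | hY
  · simp [Real.zero_rpow (by linarith : p ≠ 0)]
  · exact Real.self_le_rpow_of_one_le (by exact_mod_cast hY) hp.le

lemma IsEnvironment.ae_deviation_lt_top (hQ : IsEnvironment P Q)
    (hint : Integrable (fun ω => logMean (Q 0 ω)) P) (hpos : 0 < ∫ ω, logMean (Q 0 ω) ∂P)
    {p : ℝ} (hp : 1 < p) (hK : ∫⁻ ω, relMoment p (Q 0 ω) ∂P < ∞) :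
    ∀ᵐ ω ∂P, deviation p (fun i => Q i ω) < ∞ := by
  refine ae_tsum_mul_exp_neg_lt_top (fun n => (measurable_relMoment p).comp (hQ.measurable n)) hK
    (fun n => ((hQ.identDistrib n).comp (measurable_relMoment p)).lintegral_eq.le)
    (mul_pos (sub_pos.2 hp) hpos) ?_
  filter_upwards [hQ.ae_tendsto_walk_div hint] with ω h
  simpa only [mul_div_assoc] using h.const_mul (p - 1)

lemma IsEnvironment.ae_iSup_normalizedMean_lt_top (hQ : IsEnvironment P Q)
    (hint : Integrable (fun ω => logMean (Q 0 ω)) P) (hpos : 0 < ∫ ω, logMean (Q 0 ω) ∂P)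
    (himm : ∫⁻ ω, immMean (Q 0 ω) ∂P < ∞) (k : ℕ) :
    ∀ᵐ ω ∂P, ⨆ n, normalizedMean k (fun i => Q i ω) n < ∞ := by
  have h := ae_tsum_mul_exp_neg_lt_top (P := P) (T := fun n ω => walk (fun i => Q i ω) (n + 1))
    (fun n => measurable_immMean.comp (hQ.measurable n)) himm
    (fun n => ((hQ.identDistrib n).comp measurable_immMean).lintegral_eq.le) hpos ?_
  · filter_upwards [h] with ω h
    refine lt_of_le_of_lt (iSup_le fun n => ?_)
      (ENNReal.add_lt_top.2 ⟨ENNReal.natCast_lt_top k, h⟩)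
    exact add_le_add_right (ENNReal.sum_le_tsum (Finset.range n)) _
  · filter_upwards [hQ.ae_tendsto_walk_div hint] with ω h
    have h1 := (h.comp (tendsto_add_atTop_nat 1)).mul
      ((tendsto_one_div_atTop_nhds_zero_nat (𝕜 := ℝ)).const_add 1)
    rw [add_zero, mul_one] at h1
    refine h1.congr' ?_
    filter_upwards [eventually_gt_atTop 0] with n hn
    have hn' : (n : ℝ) ≠ 0 := Nat.cast_ne_zero.2 hn.ne'
    simp only [Function.comp]
    push_cast
    field_simp

/-! ### Recurrence of good environments -/

lemma IsEnvironment.identDistrib_shift (hQ : IsEnvironment P Q) (m : ℕ) :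
    IdentDistrib (fun ω i => Q (m + i) ω) (fun ω i => Q i ω) P P :=
  IdentDistrib.pi (fun i => (hQ.identDistrib (m + i)).trans (hQ.identDistrib i).symm)
    (hQ.indep.precomp (add_right_injective m)) hQ.indep

/-- A property of environments that has positive probability holds almost surely for infinitely
many shifts of the environment: the event that it does has positive probability by stationarity,
and it belongs to the tail `σ`-algebra. -/
lemma IsEnvironment.ae_frequently_shift_mem (hQ : IsEnvironment P Q) [IsProbabilityMeasure P]
    {B : Set (ℕ → Env)} (hB : MeasurableSet B) (hpos : 0 < P {ω | (fun i => Q i ω) ∈ B}) :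
    ∀ᵐ ω ∂P, ∃ᶠ m in atTop, (fun i => Q (m + i) ω) ∈ B := by
  set A : ℕ → Set Ω := fun m => {ω | (fun i => Q (m + i) ω) ∈ B} with hA
  have hmeas (m : ℕ) : MeasurableSet (A m) :=
    (measurable_pi_lambda _ fun i => hQ.measurable (m + i)) hB
  have hPA (m : ℕ) : P (A m) = P {ω | (fun i => Q i ω) ∈ B} :=
    (hQ.identDistrib_shift m).measure_mem_eq hB
  set U : ℕ → Set Ω := fun n => ⋃ m ≥ n, A m with hU
  have hUanti : Antitone U := fun a b hab =>
    Set.biUnion_subset_biUnion_left fun m (hm : b ≤ m) => hab.trans hm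
  have hUmeas (n : ℕ) : MeasurableSet (U n) :=
    MeasurableSet.iUnion fun m => MeasurableSet.iUnion fun _ => hmeas m
  have hlim := tendsto_measure_iInter_atTop (μ := P) (s := U)
    (fun n => (hUmeas n).nullMeasurableSet) hUanti ⟨0, measure_ne_top _ _⟩
  have hge : P {ω | (fun i => Q i ω) ∈ B} ≤ P (⋂ n, U n) := by
    refine ge_of_tendsto' hlim fun n => ?_
    rw [← hPA n]
    exact measure_mono (Set.subset_biUnion_of_mem (u := A) (le_refl n))
  have htail : MeasurableSet[limsup (fun n => MeasurableSpace.comap (Q n) inferInstance) atTop]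
      (⋂ n, U n) := by
    rw [limsup_eq_iInf_iSup_of_nat, MeasurableSpace.measurableSet_iInf]
    intro n
    have h1 : ⋂ j, U j = ⋂ j, U (n + j) := by
      refine Set.Subset.antisymm (Set.subset_iInter fun j => Set.iInter_subset _ _)
        (Set.subset_iInter fun j => (Set.iInter_subset _ j).trans (hUanti (Nat.le_add_left j n)))
    rw [h1]
    refine MeasurableSet.iInter fun j => MeasurableSet.iUnion fun m => MeasurableSet.iUnion
      fun hm => ?_
    refine (@measurable_pi_lambda _ _ _ (_) _ _ fun i => ?_) hB
    have h2 : MeasurableSpace.comap (Q (m + i)) inferInstance ≤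
        ⨆ i ≥ n, MeasurableSpace.comap (Q i) inferInstance :=
      le_iSup₂_of_le (m + i) (by omega) le_rfl
    exact (comap_measurable (Q (m + i))).mono h2 le_rfl
  have h01 := measure_zero_or_one_of_measurableSet_limsup_atTop
    (fun n => (hQ.measurable n).comap_le) ((iIndepFun_iff_iIndep _ _ _).1 hQ.indep) htail
  have h1 : P (⋂ n, U n) = 1 := h01.resolve_left (hpos.trans_le hge).ne'
  have h2 : ∀ᵐ ω ∂P, ω ∈ ⋂ n, U n :=
    (mem_ae_iff_prob_eq_one (MeasurableSet.iInter hUmeas)).2 h1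
  filter_upwards [h2] with ω hω
  rw [frequently_atTop]
  intro n
  simpa [hU, hA] using Set.mem_iInter.1 hω n

/-! ### The lower bound: vanishing of the generating functions -/

/-- Environments for which immigration in the first step is likely and the deviation from the
second step on is small. -/
def goodSet (p r : ℝ) : Set (ℕ → Env) :=
  {e | ((e 0).2 : Measure ℕ) {0} ≤ ENNReal.ofReal (1 - r) ∧
    deviation p (fun j => e (1 + j)) ≤ ENNReal.ofReal r⁻¹}

lemma measurableSet_goodSet (p r : ℝ) : MeasurableSet (goodSet p r) := by
  rw [goodSet, Set.ofPred_and]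
  refine MeasurableSet.inter (measurableSet_le ?_ measurable_const)
    (measurableSet_le ?_ measurable_const)
  · exact (measurable_apply_singleton 0).comp (measurable_pi_apply 0).snd
  · exact (measurable_deviation p).comp (measurable_pi_lambda _ fun j => measurable_pi_apply _)

lemma gen_ofReal_le {ν : ProbabilityMeasure ℕ} {r x : ℝ}
    (h : (ν : Measure ℕ) {0} ≤ ENNReal.ofReal (1 - r)) (hr : r ≤ 1) (hx0 : 0 ≤ x) (hx1 : x ≤ 1) :
    gen ν (ENNReal.ofReal x) ≤ ENNReal.ofReal (1 - r * (1 - x)) := by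
  set a := (ν : Measure ℕ).real {0} with ha
  have ha1 : a ≤ 1 - r := ENNReal.toReal_le_of_le_ofReal (by linarith) h
  have hle : gen ν (ENNReal.ofReal x) ≤
      (ν : Measure ℕ) {0} + ENNReal.ofReal x * (ν : Measure ℕ) {0}ᶜ := by
    rw [gen_eq_lintegral, ← lintegral_indicator_one (measurableSet_singleton 0),
      ← lintegral_indicator_const (measurableSet_singleton 0).compl,
      ← lintegral_add_left (measurable_of_countable _)]
    refine lintegral_mono fun j => ?_
    rcases eq_or_ne j 0 with rfl | hj
    · simp
    · simpa [hj] using pow_le_of_le_one zero_le (ENNReal.ofReal_le_one.2 hx1) hj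
  refine hle.trans ?_
  rw [prob_compl_eq_one_sub (measurableSet_singleton 0), ← ofReal_measureReal (s := {0}), ← ha,
    ← ENNReal.ofReal_one, ← ENNReal.ofReal_sub _ measureReal_nonneg, ← ENNReal.ofReal_mul hx0,
    ← ENNReal.ofReal_add measureReal_nonneg (mul_nonneg hx0 ?_)]
  · exact ENNReal.ofReal_le_ofReal (by nlinarith)
  · linarith [measureReal_le_one (μ := (ν : Measure ℕ)) (s := {0})]

lemma walk_shift (e : ℕ → Env) (m l : ℕ) :
    walk (fun j => e (m + j)) l = walk e (m + l) - walk e m := by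
  simp [walk, Finset.sum_range_add]

/-- Each good time `i` contributes to the generating function at `exp (-(b n * exp (-S_n)))`
a factor bounded away from `1`, since the immigrants that arrive at time `i + 1` have about
`exp (S_n - S_{i+1})` descendants at time `n`. -/
lemma tendsto_quenchedGen_zero (k : ℕ) {p r : ℝ} (hp : 1 < p) (hp2 : p ≤ 2) (hr : 0 < r)
    (hr1 : r ≤ 1) {e : ℕ → Env} (h0 : ∀ j, 0 < mean (e j)) (h1 : ∀ j, mean (e j) < ∞)
    (hK : ∀ j, relMoment p (e j) < ∞) (hfreq : ∃ᶠ m in atTop, (fun i => e (m + i)) ∈ goodSet p r)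
    {b : ℕ → ℝ} (hb : Tendsto b atTop atTop) :
    Tendsto (fun n => quenchedGen k e n
      (ENNReal.ofReal (Real.exp (-(b n * Real.exp (-walk e n)))))) atTop (𝓝 0) := by
  obtain ⟨c, hc, hcr⟩ : ∃ c : ℝ, 0 < c ∧ c ^ (p - 1) * r⁻¹ ≤ 1 / 2 := by
    refine ⟨(r / 2) ^ (p - 1)⁻¹, Real.rpow_pos_of_pos (by linarith) _, ?_⟩
    rw [Real.rpow_inv_rpow (by linarith) (by linarith)]
    field_simp
    rfl
  set x := Real.exp (-(c / 2)) with hx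
  have hx1 : x < 1 := Real.exp_lt_one_iff.2 (by linarith)
  set γ := ENNReal.ofReal (1 - r * (1 - x)) with hγ
  have hγ1 : γ < 1 := ENNReal.ofReal_lt_one.2 (by nlinarith)
  have hgood (m : ℕ) (hm : (fun i => e (m + i)) ∈ goodSet p r) : ∀ᶠ n in atTop,
      m < n ∧ gen (e m).2 (comp (fun j => e (m + 1 + j)) (n - 1 - m)
        (ENNReal.ofReal (Real.exp (-(b n * Real.exp (-walk e n)))))) ≤ γ := by
    filter_upwards [hb.eventually_ge_atTop (c * Real.exp (walk e (m + 1))),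
      eventually_gt_atTop m] with n hbn hmn
    refine ⟨hmn, le_trans (gen_mono _ ?_) (gen_ofReal_le hm.1 hr1 (Real.exp_pos _).le hx1.le)⟩
    have hdev : deviation p (fun j => e (m + 1 + j)) ≤ ENNReal.ofReal r⁻¹ := by
      have := hm.2
      simpa only [← add_assoc] using this
    refine le_trans (comp_mono _ _ (ENNReal.ofReal_le_ofReal ?_))
      (comp_exp_neg_le_of_deviation_le hp hp2 (fun j => h0 _) (fun j => h1 _) (fun j => hK _)
        (inv_pos.2 hr) hdev hc hcr (n - 1 - m))
    rw [Real.exp_le_exp, neg_le_neg_iff, walk_shift, show m + 1 + (n - 1 - m) = n by omega,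
      neg_sub, sub_eq_add_neg, Real.exp_add, ← mul_assoc]
    exact mul_le_mul_of_nonneg_right hbn (Real.exp_pos _).le
  refine ENNReal.tendsto_nhds_zero.2 fun ε hε => ?_
  obtain ⟨M, hM⟩ : ∃ M : ℕ, γ ^ M < ε := by
    exact ((ENNReal.tendsto_pow_atTop_nhds_zero_of_lt_one hγ1).eventually_lt_const hε).exists
  obtain ⟨I, hI, hIM⟩ := (Nat.frequently_atTop_iff_infinite.1 hfreq).exists_subset_card_eq M
  have hev := (Filter.eventually_all_finset I).2 fun m hm => hgood m (hI hm)
  filter_upwards [hev, hb.eventually_ge_atTop 0] with n hn hbn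
  have hs : ENNReal.ofReal (Real.exp (-(b n * Real.exp (-walk e n)))) ≤ 1 := by
    rw [ENNReal.ofReal_le_one, Real.exp_le_one_iff, neg_nonpos]
    positivity
  refine (quenchedGen_le_prod k e n hs).trans (le_trans ?_ hM.le)
  calc _ ≤ ∏ m ∈ I, gen (e m).2 (comp (fun j => e (m + 1 + j)) (n - 1 - m)
        (ENNReal.ofReal (Real.exp (-(b n * Real.exp (-walk e n)))))) :=
        Finset.prod_le_prod_of_subset_of_le_one' (fun m hm => Finset.mem_range.2 (hn m hm).1)
          fun m _ _ => gen_le_one _ (comp_le_one _ _ hs)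
    _ ≤ ∏ m ∈ I, γ := Finset.prod_le_prod' fun m hm => (hn m hm).2
    _ = γ ^ M := by rw [Finset.prod_const, hIM]

lemma IsEnvironment.exists_goodSet_pos (hQ : IsEnvironment P Q)
    (himm : 0 < P {ω | ((Q 0 ω).2 : Measure ℕ) {0} < 1}) {p : ℝ}
    (hdev : ∀ᵐ ω ∂P, deviation p (fun i => Q i ω) < ∞) :
    ∃ r, 0 < r ∧ r ≤ 1 ∧ 0 < P {ω | (fun i => Q i ω) ∈ goodSet p r} := by
  have hdev' : ∀ᵐ ω ∂P, deviation p (fun i => Q (1 + i) ω) < ∞ :=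
    (hQ.identDistrib_shift 1).symm.ae_snd (p := fun e => deviation p e < ∞)
      (measurableSet_lt (measurable_deviation p) measurable_const) hdev
  by_contra! hcon
  have hz (n : ℕ) : P {ω | (fun i => Q i ω) ∈ goodSet p (1 / ((n : ℝ) + 1))} = 0 :=
    le_antisymm (hcon _ (by positivity) (by
      rw [div_le_one (by positivity)]
      linarith [n.cast_nonneg (α := ℝ)])) bot_le
  refine himm.ne' (measure_mono_null_ae ?_ (measure_iUnion_null hz))
  filter_upwards [hdev'] with ω hω h
  have h : ((Q 0 ω).2 : Measure ℕ) {0} < 1 := h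
  refine Set.mem_iUnion.2 ?_
  set a := ((Q 0 ω).2 : Measure ℕ).real {0} with ha
  have ha1 : a < 1 := by
    rw [ha, measureReal_def]
    exact ENNReal.toReal_lt_of_lt_ofReal (by simpa using h)
  obtain ⟨n1, hn1⟩ := exists_nat_one_div_lt (sub_pos.2 ha1)
  obtain ⟨n2, hn2⟩ := exists_nat_ge (deviation p fun i => Q (1 + i) ω).toReal
  refine ⟨max n1 n2, ?_, ?_⟩
  · rw [← ofReal_measureReal (s := {0})]
    refine ENNReal.ofReal_le_ofReal ?_
    have : 1 / (((max n1 n2 : ℕ) : ℝ) + 1) ≤ 1 / ((n1 : ℝ) + 1) :=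
      Nat.one_div_le_one_div (le_max_left _ _)
    linarith
  · rw [← ENNReal.ofReal_toReal hω.ne]
    refine ENNReal.ofReal_le_ofReal ?_
    rw [one_div, inv_inv]
    have : (n2 : ℝ) ≤ (max n1 n2 : ℕ) := Nat.cast_le.2 (le_max_right _ _)
    linarith

/-- In probability, the population is not much smaller than the product of the offspring means. -/
theorem tendsto_measure_population_small [IsProbabilityMeasure P] (hQ : IsEnvironment P Q)
    (hsuper : IsSupercritical P (Q 0)) (hC : AssumptionC P (Q 0)) (hZ : IsProcess P Q k Z)
    {b : ℕ → ℝ} (hb0 : ∀ n, 0 ≤ b n) (hb : Tendsto b atTop atTop) :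
    Tendsto (fun n => P {ω | b n * Real.exp (-walk (fun i => Q i ω) n) * Z n ω ≤ 1})
      atTop (𝓝 0) := by
  obtain ⟨q, p, -, hp, hp2, hK, -⟩ := hC
  have hKint := lintegral_relMoment_lt_top hK
  have hKfin : ∀ᵐ ω ∂P, ∀ n, relMoment p (Q n ω) < ∞ :=
    hQ.ae_forall (measurableSet_lt (measurable_relMoment p) measurable_const)
      (ae_lt_top ((measurable_relMoment p).comp (hQ.measurable 0)) hKint.ne)
  have h0 : ∀ᵐ ω ∂P, ∀ n, 0 < mean (Q n ω) :=
    hQ.ae_forall (measurableSet_lt measurable_const measurable_mean) hsuper.mean_pos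
  have h1 : ∀ᵐ ω ∂P, ∀ n, mean (Q n ω) < ∞ :=
    hQ.ae_forall (measurableSet_lt measurable_mean measurable_const) hsuper.mean_lt_top
  obtain ⟨r, hr, hr1, hpos⟩ := hQ.exists_goodSet_pos hsuper.immigration
    (hQ.ae_deviation_lt_top hsuper.integrable hsuper.drift_pos hp hKint)
  have hfreq := hQ.ae_frequently_shift_mem (measurableSet_goodSet p r) hpos
  set s : ℕ → (ℕ → Env) → ℝ≥0∞ := fun n e =>
    ENNReal.ofReal (Real.exp (-(b n * Real.exp (-walk e n)))) with hs
  have hsm (n : ℕ) : Measurable (s n) :=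
    (Real.measurable_exp.comp
      ((Real.measurable_exp.comp (measurable_walk n).neg).const_mul _).neg).ennreal_ofReal
  have hs1 (n : ℕ) (e : ℕ → Env) : s n e ≤ 1 := by
    rw [hs, ENNReal.ofReal_le_one, Real.exp_le_one_iff, neg_nonpos]
    exact mul_nonneg (hb0 n) (Real.exp_pos _).le
  have hξ : Measurable fun ω => (fun i => Q i ω) := measurable_pi_lambda _ hQ.measurable
  have hlim : Tendsto (fun n => ∫⁻ ω, quenchedGen k (fun i => Q i ω) n (s n fun i => Q i ω) ∂P)
      atTop (𝓝 0) := by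
    have := tendsto_lintegral_of_dominated_convergence (μ := P)
      (F := fun n ω => quenchedGen k (fun i => Q i ω) n (s n fun i => Q i ω)) (f := fun _ => 0)
      (fun _ => 1) (fun n => (measurable_quenchedGen k n).comp (hξ.prodMk ((hsm n).comp hξ)))
      (fun n => ae_of_all _ fun ω => quenchedGen_le_one k _ n (hs1 n _)) (by simp) (by
        filter_upwards [hKfin, h0, h1, hfreq] with ω hK h0 h1 hf
        exact tendsto_quenchedGen_zero k hp hp2 hr hr1 h0 h1 hK hf hb)
    simpa using this
  -- Markov's inequality for `exp (1 - b n * exp (-S_n) * Z n)`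
  have hlim2 := ENNReal.Tendsto.const_mul (a := ENNReal.ofReal (Real.exp 1)) hlim
    (Or.inr ENNReal.ofReal_ne_top)
  rw [mul_zero] at hlim2
  refine tendsto_of_tendsto_of_tendsto_of_le_of_le tendsto_const_nhds hlim2
    (fun n => bot_le) fun n => ?_
  have hI := lintegral_mul_pow hQ.measurable hZ n (X := fun _ => 1) measurable_const (hsm n)
  simp only [one_mul] at hI
  have hW : Measurable fun ω => walk (fun i => Q i ω) n := (measurable_walk n).comp hξ
  have hZm : Measurable fun ω => (Z n ω : ℝ) := (measurable_of_countable _).comp (hZ.measurable n)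
  have hset : MeasurableSet {ω | b n * Real.exp (-walk (fun i => Q i ω) n) * Z n ω ≤ 1} :=
    measurableSet_le (((Real.measurable_exp.comp hW.neg).const_mul _).mul hZm) measurable_const
  dsimp only
  rw [← hI, ← lintegral_indicator_one hset, ← lintegral_const_mul' _ _ ENNReal.ofReal_ne_top]
  refine lintegral_mono fun ω => Set.indicator_apply_le' (fun hω => ?_) fun _ => bot_le
  have hω : b n * Real.exp (-walk (fun i => Q i ω) n) * Z n ω ≤ 1 := hω
  rw [hs, ← ENNReal.ofReal_pow (Real.exp_pos _).le, ← Real.exp_nat_mul,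
    ← ENNReal.ofReal_mul (Real.exp_pos _).le, ← Real.exp_add, Pi.one_apply, ← ENNReal.ofReal_one]
  refine ENNReal.ofReal_le_ofReal (Real.one_le_exp ?_)
  linarith

/-! ### The upper bound -/

/-- In probability, the population is not much larger than the product of the offspring means. -/
theorem tendsto_measure_population_large [IsProbabilityMeasure P] (hQ : IsEnvironment P Q)
    (hsuper : IsSupercritical P (Q 0)) (hC : AssumptionC P (Q 0)) (hZ : IsProcess P Q k Z)
    {b : ℕ → ℝ} (hb : Tendsto b atTop atTop) :
    Tendsto (fun n => P {ω | b n ≤ Real.exp (-walk (fun i => Q i ω) n) * Z n ω})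
      atTop (𝓝 0) := by
  obtain ⟨q, p, -, hp, hp2, -, hY⟩ := hC
  have h0 : ∀ᵐ ω ∂P, ∀ n, 0 < mean (Q n ω) :=
    hQ.ae_forall (measurableSet_lt measurable_const measurable_mean) hsuper.mean_pos
  have h1 : ∀ᵐ ω ∂P, ∀ n, mean (Q n ω) < ∞ :=
    hQ.ae_forall (measurableSet_lt measurable_mean measurable_const) hsuper.mean_lt_top
  set C : (ℕ → Env) → ℝ≥0∞ := fun e => ⨆ n, normalizedMean k e n with hCdef
  have hw (n : ℕ) : Measurable fun e : ℕ → Env => ENNReal.ofReal (Real.exp (-walk e n)) :=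
    (Real.measurable_exp.comp (measurable_walk n).neg).ennreal_ofReal
  have hCm : Measurable C := Measurable.iSup fun n => measurable_const.add
    (Finset.measurable_fun_sum _ fun i _ =>
      (measurable_immMean.comp (measurable_pi_apply i)).mul (hw _))
  have hCfin : ∀ᵐ ω ∂P, C (fun i => Q i ω) < ∞ := hQ.ae_iSup_normalizedMean_lt_top
    hsuper.integrable hsuper.drift_pos (lintegral_immMean_lt_top hp hY) k
  have hξ : Measurable fun ω => (fun i => Q i ω) := measurable_pi_lambda _ hQ.measurable
  have htail : Tendsto (fun R : ℕ => P {ω | (R : ℝ≥0∞) < C fun i => Q i ω}) atTop (𝓝 0) := by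
    have h := tendsto_measure_iInter_atTop (μ := P)
      (s := fun R : ℕ => {ω | (R : ℝ≥0∞) < C fun i => Q i ω})
      (fun R => (measurableSet_lt measurable_const (hCm.comp hξ)).nullMeasurableSet)
      (fun R S hRS ω (hω : (S : ℝ≥0∞) < _) => lt_of_le_of_lt (Nat.cast_le.2 hRS) hω)
      ⟨0, measure_ne_top _ _⟩
    have hnull : P (⋂ R : ℕ, {ω | (R : ℝ≥0∞) < C fun i => Q i ω}) = 0 := by
      refine measure_mono_null_ae ?_ (measure_empty (μ := P))
      filter_upwards [hCfin] with ω hω hmem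
      obtain ⟨R, hR⟩ := ENNReal.exists_nat_gt hω.ne
      exact (lt_asymm hR (Set.mem_iInter.1 hmem R)).elim
    rwa [hnull] at h
  refine ENNReal.tendsto_nhds_zero.2 fun ε hε => ?_
  -- Markov's inequality is applied on the event that the bound `C` is at most `R`
  obtain ⟨R, hR⟩ := (htail.eventually_lt_const (ENNReal.half_pos hε.ne')).exists
  have hdiv : Tendsto (fun n => (R : ℝ≥0∞) / ENNReal.ofReal (b n)) atTop (𝓝 0) :=
    ENNReal.Tendsto.const_div (b := ∞) (ENNReal.tendsto_ofReal_atTop.comp hb)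
      (Or.inr (ENNReal.natCast_ne_top R)) |>.trans (by simp)
  filter_upwards [hdiv.eventually_lt_const (ENNReal.half_pos hε.ne'), hb.eventually_gt_atTop 0]
    with n hn hbn
  set X : (ℕ → Env) → ℝ≥0∞ := Set.indicator {e | C e ≤ R} 1 with hX
  have hXm : Measurable X := measurable_one.indicator (measurableSet_le hCm measurable_const)
  have hI := lintegral_mul_population hQ.measurable hZ h0 h1 n hXm
  have hIle : ∫⁻ ω, X (fun i => Q i ω) * normalizedMean k (fun i => Q i ω) n ∂P ≤ R := by
    calc _ ≤ ∫⁻ ω, (R : ℝ≥0∞) ∂P := lintegral_mono fun ω => by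
          by_cases h : C (fun i => Q i ω) ≤ R
          · rw [hX, Set.indicator_of_mem (by exact h), Pi.one_apply, one_mul]
            exact (le_iSup (fun n => normalizedMean k (fun i => Q i ω) n) n).trans h
          · rw [hX, Set.indicator_of_notMem (by exact h), zero_mul]
            exact bot_le
      _ = R := by simp
  rw [← hI] at hIle
  have hmarkov := meas_ge_le_lintegral_div (μ := P) (f := fun ω => X (fun i => Q i ω) *
      (ENNReal.ofReal (Real.exp (-walk (fun i => Q i ω) n)) * Z n ω))
    (((hXm.comp hξ).mul (((hw n).comp hξ).mul
      ((measurable_of_countable (fun z : ℕ => (z : ℝ≥0∞))).comp (hZ.measurable n)))).aemeasurable)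
    (ε := ENNReal.ofReal (b n)) (ENNReal.ofReal_pos.2 hbn).ne' ENNReal.ofReal_ne_top
  calc P {ω | b n ≤ Real.exp (-walk (fun i => Q i ω) n) * Z n ω}
      ≤ P ({ω | (R : ℝ≥0∞) < C fun i => Q i ω} ∪
        {ω | ENNReal.ofReal (b n) ≤ X (fun i => Q i ω) *
          (ENNReal.ofReal (Real.exp (-walk (fun i => Q i ω) n)) * Z n ω)}) := by
        refine measure_mono fun ω (hω : b n ≤ _) => ?_
        by_cases h : C (fun i => Q i ω) ≤ R
        · right
          change ENNReal.ofReal (b n) ≤ _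
          rw [hX, Set.indicator_of_mem (by exact h), Pi.one_apply, one_mul,
            ← ENNReal.ofReal_natCast, ← ENNReal.ofReal_mul (Real.exp_pos _).le]
          exact ENNReal.ofReal_le_ofReal hω
        · left
          exact not_le.1 h
    _ ≤ ε / 2 + ε / 2 := (measure_union_le _ _).trans (add_le_add hR.le
        (hmarkov.trans ((ENNReal.div_le_div_right hIle _).trans hn.le)))
    _ = ε := ENNReal.add_halves ε

/-! ### Comparison with the random walk and the limit theorem -/

lemma tendsto_exp_mul_sqrt {ε : ℝ} (hε : 0 < ε) :
    Tendsto (fun n : ℕ => Real.exp (ε * Real.sqrt n)) atTop atTop :=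
  Real.tendsto_exp_atTop.comp
    ((Real.tendsto_sqrt_atTop.comp tendsto_natCast_atTop_atTop).const_mul_atTop hε)

/-- The difference of `log (Z n)` and the associated random walk is `o(√n)` in probability. -/
theorem tendstoInMeasure_log_sub_walk [IsProbabilityMeasure P] (hQ : IsEnvironment P Q)
    (hsuper : IsSupercritical P (Q 0)) (hC : AssumptionC P (Q 0)) (hZ : IsProcess P Q k Z)
    {σ : ℝ} (hσ : 0 < σ) :
    TendstoInMeasure P (fun (n : ℕ) ω =>
      (Real.log (Z n ω) - walk (fun i => Q i ω) n) / (Real.sqrt n * σ)) atTop 0 := by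
  rw [tendstoInMeasure_iff_norm]
  intro ε hε
  have hb := tendsto_exp_mul_sqrt (mul_pos hε hσ)
  have h1 := tendsto_measure_population_small hQ hsuper hC hZ (fun n => (Real.exp_pos _).le) hb
  have h2 := tendsto_measure_population_large hQ hsuper hC hZ hb
  have h3 := h1.add h2
  rw [add_zero] at h3
  refine tendsto_of_tendsto_of_tendsto_of_le_of_le' tendsto_const_nhds h3
    (Eventually.of_forall fun n => bot_le) ?_
  filter_upwards [eventually_gt_atTop 0] with n hn
  refine le_trans (measure_mono fun ω hω => ?_) (measure_union_le _ _)
  have hω : ε ≤ ‖(Real.log (Z n ω) - walk (fun i => Q i ω) n) / (Real.sqrt n * σ) - 0‖ := hω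
  by_contra hcon
  simp only [Set.mem_union, Set.mem_ofPred_eq, not_or, not_le] at hcon
  obtain ⟨hl, hu⟩ := hcon
  have hn' : 0 < Real.sqrt n := Real.sqrt_pos.2 (Nat.cast_pos.2 hn)
  have hZ0 : (0 : ℝ) < Z n ω := by
    rcases (Z n ω).eq_zero_or_pos with h | h
    · rw [h] at hl
      norm_num at hl
    · exact Nat.cast_pos.2 h
  rw [← Real.exp_log hZ0, ← Real.exp_add, Real.exp_lt_exp] at hu
  rw [← Real.exp_log hZ0, ← Real.exp_add, ← Real.exp_add, Real.one_lt_exp_iff] at hl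
  rw [sub_zero, Real.norm_eq_abs, abs_div, abs_of_pos (mul_pos hn' hσ), le_div_iff₀ (by positivity)]
    at hω
  have : |Real.log (Z n ω) - walk (fun i => Q i ω) n| < ε * σ * Real.sqrt n :=
    abs_lt.2 ⟨by linarith, by linarith⟩
  linarith

/-- Survival has a probability tending to one, thanks to the immigration. -/
theorem tendsto_measure_extinct_zero [IsProbabilityMeasure P] (hQ : IsEnvironment P Q)
    (hsuper : IsSupercritical P (Q 0)) (hC : AssumptionC P (Q 0)) (hZ : IsProcess P Q k Z) :
    Tendsto (fun n => P {ω | 0 < Z n ω}ᶜ) atTop (𝓝 0) := by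
  refine tendsto_of_tendsto_of_tendsto_of_le_of_le tendsto_const_nhds
    (tendsto_measure_population_small hQ hsuper hC hZ (fun n => n.cast_nonneg)
      tendsto_natCast_atTop_atTop) (fun n => bot_le) fun n => measure_mono fun ω hω => ?_
  have h : Z n ω = 0 := by simpa using hω
  simp [h]

lemma gaussianReal_Iic (x : ℝ) : (gaussianReal 0 1).real (Set.Iic x) =
    1 / Real.sqrt (2 * Real.pi) * ∫ y in Set.Iic x, Real.exp (-y ^ 2 / 2) := by
  rw [measureReal_def, gaussianReal_apply_eq_integral 0 one_ne_zero, ENNReal.toReal_ofReal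
    (integral_nonneg fun y => gaussianPDFReal_nonneg _ _ _), ← integral_const_mul]
  simp [gaussianPDFReal_def]

theorem tendstoInDistribution_log [IsProbabilityMeasure P] (hQ : IsEnvironment P Q)
    (hsuper : IsSupercritical P (Q 0)) (hC : AssumptionC P (Q 0)) (hZ : IsProcess P Q k Z)
    {μ σ : ℝ} (hμ : μ = ∫ ω, logMean (Q 0 ω) ∂P)
    (hσ : σ = Real.sqrt (variance (fun ω => logMean (Q 0 ω)) P)) (hσpos : 0 < σ) :
    TendstoInDistribution (fun (n : ℕ) ω => (Real.log (Z n ω) - n * μ) / (Real.sqrt n * σ)) atTop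
      id (fun _ => P) (gaussianReal 0 1) := by
  have hL : Measurable fun ω => logMean (Q 0 ω) := measurable_logMean.comp (hQ.measurable 0)
  have hg : Measurable fun q => (logMean q - μ) / σ := (measurable_logMean.sub_const μ).div_const σ
  have hvar : variance (fun ω => logMean (Q 0 ω)) P = σ ^ 2 := by
    rw [hσ, Real.sq_sqrt (variance_nonneg _ _)]
  have hclt := tendstoInDistribution_inv_sqrt_mul_sum (P := P) (P' := gaussianReal 0 1)
    (Y := id) (X := fun n ω => (logMean (Q n ω) - μ) / σ) HasLaw.id ?_ ?_
    (hQ.indep.comp _ fun _ => hg) fun n => (hQ.identDistrib n).comp hg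
  · refine tendstoInDistribution_of_tendstoInMeasure_sub _ _ hclt ?_ fun n => ?_
    · convert tendstoInMeasure_log_sub_walk hQ hsuper hC hZ hσpos using 1
      funext n ω
      simp only [Pi.sub_apply, walk]
      rw [← Finset.sum_div, Finset.sum_sub_distrib, Finset.sum_const, Finset.card_range,
        nsmul_eq_mul]
      ring
    · have hZm : Measurable fun ω => (Z n ω : ℝ) :=
        (measurable_of_countable _).comp (hZ.measurable n)
      exact (((Real.measurable_log.comp hZm).sub_const _).div_const _).aemeasurable
  · rw [integral_div, integral_sub hsuper.integrable (integrable_const _)]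
    simp [hμ]
  · simp only [Pi.pow_apply, div_pow]
    rw [integral_div, hμ, ← variance_eq_integral hL.aemeasurable, hvar, div_self (by positivity)]

/-- Conditioning on events whose probabilities tend to `1` does not change a limit. -/
lemma tendsto_cond_real [IsProbabilityMeasure P] {A B : ℕ → Set Ω}
    (hB : ∀ n, MeasurableSet (B n)) (hlim : Tendsto (fun n => P (B n)ᶜ) atTop (𝓝 0)) {a : ℝ}
    (hA : Tendsto (fun n => P.real (A n)) atTop (𝓝 a)) :
    Tendsto (fun n => (cond P (B n)).real (A n)) atTop (𝓝 a) := by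
  have hlim' : Tendsto (fun n => P.real (B n)ᶜ) atTop (𝓝 0) :=
    (ENNReal.tendsto_toReal ENNReal.zero_ne_top).comp hlim
  have hB1 : Tendsto (fun n => P.real (B n)) atTop (𝓝 1) := by
    have h := hlim'.const_sub 1
    rw [sub_zero] at h
    refine h.congr fun n => ?_
    rw [probReal_compl_eq_one_sub (hB n), sub_sub_cancel]
  have hAB : Tendsto (fun n => P.real (B n ∩ A n)) atTop (𝓝 a) := by
    have h := hA.sub hlim'
    rw [sub_zero] at h
    refine tendsto_of_tendsto_of_tendsto_of_le_of_le h hA (fun n => ?_)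
      fun n => measureReal_mono Set.inter_subset_right
    have h2 : P.real (A n) ≤ P.real (B n ∩ A n) + P.real (B n)ᶜ :=
      (measureReal_mono fun ω hω => by
        by_cases h : ω ∈ B n
        · exact Or.inl ⟨h, hω⟩
        · exact Or.inr h).trans (measureReal_union_le _ _)
    simpa using h2
  have h := (hB1.inv₀ one_ne_zero).mul hAB
  rw [inv_one, one_mul] at h
  refine h.congr fun n => ?_
  rw [measureReal_def (μ := cond P (B n)), cond_apply (hB n), ENNReal.toReal_mul,
    ENNReal.toReal_inv]
  rfl

end BPIRE

theorem theorem4p1 {Ω : Type*} [MeasurableSpace Ω] (P : Measure Ω) [IsProbabilityMeasure P]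
    (Q : ℕ → Ω → BPIRE.Env) (hQ : BPIRE.IsEnvironment P Q)
    (hsuper : BPIRE.IsSupercritical P (Q 0))
    (hA : BPIRE.AssumptionA P (Q 0)) (hB : BPIRE.AssumptionB P (Q 0))
    (hC : BPIRE.AssumptionC P (Q 0))
    (hsq : Integrable (fun ω => BPIRE.logMean (Q 0 ω) ^ 2) P)
    (μ σ : ℝ) (hμ : μ = ∫ ω, BPIRE.logMean (Q 0 ω) ∂P)
    (hσ : σ = Real.sqrt (variance (fun ω => BPIRE.logMean (Q 0 ω)) P)) (hσpos : 0 < σ)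
    (k : ℕ) (hk : 1 ≤ k) (Z : ℕ → Ω → ℕ) (hZ : BPIRE.IsProcess P Q k Z) (x : ℝ) :
    Tendsto
      (fun n : ℕ => (ProbabilityTheory.cond P {ω | 0 < Z n ω}).real
        {ω | (Real.log (Z n ω : ℝ) - n * μ) / (Real.sqrt n * σ) ≤ x})
      atTop
      (𝓝 (1 / Real.sqrt (2 * Real.pi) * ∫ y in Set.Iic x, Real.exp (-y ^ 2 / 2))) := by
  rw [← BPIRE.gaussianReal_Iic]
  refine BPIRE.tendsto_cond_real (fun n => ?_) (BPIRE.tendsto_measure_extinct_zero hQ hsuper hC hZ) ?_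
  · exact measurableSet_lt measurable_const (hZ.measurable n)
  have hD := BPIRE.tendstoInDistribution_log hQ hsuper hC hZ hμ hσ hσpos
  have hna : NullSingletonClass (gaussianReal 0 1) := nullSingletonClass_gaussianReal one_ne_zero
  have h := ProbabilityMeasure.tendsto_measure_of_null_frontier_of_tendsto' hD.tendsto
    (E := Set.Iic x) (by simp [measure_singleton])
  simp only [ProbabilityMeasure.coe_mk, Measure.map_id] at h
  refine ((ENNReal.tendsto_toReal (measure_ne_top _ _)).comp h).congr fun n => ?_
  simp only [Function.comp]
  rw [Measure.map_apply_of_aemeasurable (hD.forall_aemeasurable n) measurableSet_Iic]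
  rfl
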